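/- Let $P$ be a finite graded bounded poset of rank $n$ with minimum $\hat 0$, maximum $\hat 1$, rank function $\operatorname{rk}$ and Möbius function $\mu$. For $u\le w$ in $P$ let $$\mathsf{Poin}_{[u,w]}(y)=\sum_{v\in[u,w]}\mu(u,v)\,(-y)^{\operatorname{rk}(v)-\operatorname{rk}(u)}.$$ The extended $\mathbf{a}\mathbf{b}$-index of $P$ is the polynomial $$\mathrm{ex}\Psi_P(y,\mathbf a,\mathbf b)=\sum_{\mathcal C}\Big(\prod_{i=1}^{k}\mathsf{Poin}_{[\mathcal C_i,\mathcal C_{i+1}]}(y)\Big)\cdot w_0\cdots w_{n-1}\ \in\ \mathbb Z[y]\langle\mathbf a,\mathbf b\rangle$$ in noncommuting variables $\mathbf a,\mathbf b$, where the sum is over all chains $\mathcal C=\{\mathcal C_1<\dots<\mathcal C_k<\mathcal C_{k+1}=\hat 1\}$ in $P$ ending in $\hat 1$ ($k\ge 0$), and $w_j=\mathbf b$ if $j\in\{\operatorname{rk}(\mathcal C_1),\dots,\operatorname{rk}(\mathcal C_k)\}$ and $w_j=\mathbf a-\mathbf b$ otherwise. An $R$-labeling of $P$ is a labeling $\lambda$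 of the cover relations of $P$ by integers such that every interval $[x,y]$ of $P$ has exactly one maximal chain along which the labels weakly increase. Let $\lambda$ be an $R$-labeling of $P$ with nonnegative labels. For a maximal chain $\mathcal M=(\mathcal M_0<\dots<\mathcal M_n)$ of $P$ and $E\subseteq\{1,\dots,n\}$ put $\lambda_0=0$ and, for $1\le i\le n$, $\lambda_i=-\lambda(\mathcal M_{i-1},\mathcal M_i)$ if $i\in E$ and $\lambda_i=\lambda(\mathcal M_{i-1},\mathcal M_i)$ if $i\notin E$. Let $\operatorname{m}(\mathcal M,E)=m_0\cdots m_{n-1}$, where $m_i=\mathbf b$ if $\lambda_i>\lambda_{i+1}$, or if $\lambda_i=\lambda_{i+1}$ and $i+1\in E$, and $m_i=\mathbf a$ otherwise. Then $$\mathrm{ex}\Psi_P(y,\mathbf a,\mathbf b)=\sum_{\mathcal M,E}y^{\#E}\cdot\operatorname{m}(\mathcal M,E),$$ where the sum ranges over all maximal chains $\mathcal M$ of $P$ and all subsets $E\subseteq\{1,\dots,n\}$. If moreover all labels are positive and $\lambda(x,y)\ne\lambda(y,z)$ whenever $y$ covers $x$ and $z$ covers $y$, then the same identity holds with the plain descent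 rule: $m_i=\mathbf b$ if $\lambda_i>\lambda_{i+1}$ and $m_i=\mathbf a$ if $\lambda_i\le\lambda_{i+1}$. -/

import Mathlib

open Polynomial

namespace ABIndex

/-- The ring `ℤ[y]⟨a, b⟩` of polynomials in two noncommuting variables with coefficients in `ℤ[y]`;
the variable `y` is `Polynomial.X`. -/
abbrev ABRing : Type := FreeAlgebra ℤ[X] (Fin 2)

/-- The noncommuting variable `a`. -/
noncomputable def a : ABRing := FreeAlgebra.ι ℤ[X] 0

/-- The noncommuting variable `b`. -/
noncomputable def b : ABRing := FreeAlgebra.ι ℤ[X] 1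

section Poset

variable {P : Type*} [PartialOrder P] [GradeMinOrder ℕ P]

/-- The Poincaré polynomial of the interval `[u, w]`, namely
`∑_{v ∈ [u, w]} μ(u, v) (-y)^(rk v - rk u)`. The Poincaré polynomial of a bounded poset is that
of the interval `[⊥, ⊤]`. -/
noncomputable def poin [LocallyFiniteOrder P] [DecidableEq P] (u w : P) : ℤ[X] :=
  ∑ v ∈ Finset.Icc u w,
    C (IncidenceAlgebra.mu ℤ u v) * (-X) ^ (grade ℕ v - grade ℕ u)

open Classical in
/-- The chain Poincaré polynomial: the product of the Poincaré polynomials of the intervals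
between consecutive elements of the chain `c`. -/
noncomputable def chainPoin [LocallyFiniteOrder P] [DecidableEq P] (c : Finset P) : ℤ[X] :=
  ∏ p ∈ (c ×ˢ c).filter (fun p => p.1 < p.2 ∧ ∀ v ∈ c, ¬ (p.1 < v ∧ v < p.2)), poin p.1 p.2

/-- The word `w_0 ⋯ w_{n-1}` with `w_k = b` for `k ∈ S` and `w_k = a - b` for `k ∉ S`. -/
noncomputable def wt (n : ℕ) (S : Finset ℕ) : ABRing :=
  (List.ofFn fun k : Fin n => if (k : ℕ) ∈ S then b else a - b).prod

variable (P) in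
open Classical in
/-- The Poincaré-extended `ab`-index of a finite graded bounded poset `P` of rank
`grade ℕ (⊤ : P)`. The sum ranges over all chains of `P` containing the maximum `⊤`; the weight of
a chain is given by the ranks of its elements other than `⊤`. -/
noncomputable def exPsi [BoundedOrder P] [Fintype P] [LocallyFiniteOrder P] [DecidableEq P] :
    ABRing :=
  ∑ c ∈ (Finset.univ : Finset (Finset P)).filter
      (fun c : Finset P => IsChain (· ≤ ·) (c : Set P) ∧ (⊤ : P) ∈ c),
    chainPoin c • wt (grade ℕ (⊤ : P)) ((c.erase ⊤).image (grade ℕ))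

/-- `c_0 ⋖ c_1 ⋖ ⋯ ⋖ c_k` is a maximal chain of length `k` in the interval `[x, y]`. -/
def IsMaximalChain {k : ℕ} (x y : P) (c : Fin (k + 1) → P) : Prop :=
  c 0 = x ∧ c (Fin.last k) = y ∧ ∀ i : Fin k, c i.castSucc ⋖ c i.succ

/-- `lam` is an `R`-labeling: every interval `[x, y]` has exactly one maximal chain along which
the labels weakly increase. Only the labels `lam x y` of cover relations `x ⋖ y` are relevant.
In a graded poset all maximal chains of `[x, y]` have length `rk y - rk x`. -/
def IsRLabeling (lam : P → P → ℤ) : Prop :=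
  ∀ x y : P, x ≤ y →
    ∃! c : Fin (grade ℕ y - grade ℕ x + 1) → P,
      IsMaximalChain x y c ∧
        Monotone fun i : Fin (grade ℕ y - grade ℕ x) => lam (c i.castSucc) (c i.succ)

variable (P) in
open Classical in
/-- The set of all maximal chains `M_0 ⋖ M_1 ⋖ ⋯ ⋖ M_n` of a bounded graded poset of rank `n`. -/
noncomputable def maximalChains [BoundedOrder P] [Fintype P] :
    Finset (Fin (grade ℕ (⊤ : P) + 1) → P) :=
  Finset.univ.filter fun M => IsMaximalChain ⊥ ⊤ M

end Poset

section Monomials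

variable {P : Type*} {n : ℕ}

/-- The sequence `(λ_0, λ_1, …, λ_n)` with `λ_0 = 0` and `λ_i = ± lam (M_{i-1}) (M_i)`, where the
sign is negative if and only if `i ∈ E`. -/
def signedLabels (lam : P → P → ℤ) (M : Fin (n + 1) → P) (E : Finset ℕ) : Fin (n + 1) → ℤ :=
  Fin.cases 0 fun i : Fin n =>
    if (i : ℕ) + 1 ∈ E then -lam (M i.castSucc) (M i.succ) else lam (M i.castSucc) (M i.succ)

/-- The monomial `m_0 ⋯ m_{n-1}` with `m_i = b` if `λ_i > λ_{i+1}` and `m_i = a` if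
`λ_i ≤ λ_{i+1}`. -/
noncomputable def mon (lam : P → P → ℤ) (M : Fin (n + 1) → P) (E : Finset ℕ) : ABRing :=
  (List.ofFn fun i : Fin n =>
    if signedLabels lam M E i.castSucc > signedLabels lam M E i.succ then b else a).prod

/-- The monomial `m_0 ⋯ m_{n-1}` with `m_i = b` if `λ_i > λ_{i+1}`, or if `λ_i = λ_{i+1}` and
`i + 1 ∈ E`, and `m_i = a` otherwise. It differs from `mon` only in that a tie at a negated
label counts as a descent. -/
noncomputable def monTie (lam : P → P → ℤ) (M : Fin (n + 1) → P) (E : Finset ℕ) : ABRing :=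
  (List.ofFn fun i : Fin n =>
    if signedLabels lam M E i.castSucc > signedLabels lam M E i.succ ∨
        (signedLabels lam M E i.castSucc = signedLabels lam M E i.succ ∧ (i : ℕ) + 1 ∈ E)
      then b else a).prod

end Monomials

end ABIndex

/-! Substitute `a = b + (a - b)` in the descent words. The letter `b` can then be chosen at every
position, but `a - b` only where there is no descent. So the coefficient of a word in `b` and `a -
b` is a weighted count of signed maximal chains without descents at the positions carrying `a - b`.
Cutting such a chain at the ranks carrying `b` gives the elements `C_1 < ... < C_k < ⊤`, and the
count factors over the intervals `[C_i, C_{i+1}]`: each contributes the generating function of its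
signed maximal chains with no internal descent (`wordSum_eq_sum`, `exPsiFrom_eq_wordSum`).

This generating function is the Poincaré polynomial (`poin_eq_ascSum`). As labels are nonnegative
and a tie at a negated label is a descent, a sequence without descents is a strictly decreasing run
of negated labels followed by a weakly increasing run of unnegated ones. The R-labeling makes the
second run unique once its starting point `v` is fixed, so the sum is `∑_v y^(rk v - rk u) d(u, v)`,
where `d` counts strictly decreasing maximal chains. At `y = -1` a sign change cancels everything
unless `u = w`; this is the recursion of the Möbius function, whence `μ(u, v) = (-1)^(rk v - rk u)
d(u, v)`.

The run from `⊥` to `C_1` is preceded by `λ_0 = 0`, which excludes negated labels; it contributes 1,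
in accordance with the missing Poincaré factor.

Throughout, `s` exceeds every `|lam x y|`: a preceding label `s` forces the letter `b`, and a
preceding label `-s` imposes no condition. -/

namespace ABIndex

/-! ### Signed maximal chains without descents -/

section Paths

open scoped Classical in
/-- The maximal chains of length `k` from `u` to `w`. -/
noncomputable def chainsOfLength {P : Type*} [PartialOrder P] [Fintype P]
    (k : ℕ) (u w : P) : Finset (Fin (k + 1) → P) :=
  Finset.univ.filter fun c => IsMaximalChain u w c

open scoped Classical in
/-- The elements covering `u`. -/
noncomputable def upperCovers {P : Type*} [PartialOrder P] [Fintype P] (u : P) : Finset P :=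
  Finset.univ.filter fun x => u ⋖ x

theorem mem_upperCovers {P : Type*} [PartialOrder P] [Fintype P] {u x : P} :
    x ∈ upperCovers u ↔ u ⋖ x := by
  simp [upperCovers]

variable {P : Type*} [PartialOrder P] [Fintype P]

theorem mem_chainsOfLength {k : ℕ} {u w : P} {c : Fin (k + 1) → P} :
    c ∈ chainsOfLength k u w ↔ IsMaximalChain u w c := by
  simp [chainsOfLength]

theorem isMaximalChain_cons {P : Type*} [PartialOrder P] {k : ℕ} {u u' w : P} {c : Fin (k + 1) → P} :
    IsMaximalChain u w (Fin.cons u' c : Fin (k + 1 + 1) → P) ↔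
      u' = u ∧ u ⋖ c 0 ∧ IsMaximalChain (c 0) w c := by
  constructor
  · rintro ⟨h0, h1, h2⟩
    simp only [Fin.cons_zero] at h0
    subst h0
    refine ⟨rfl, by simpa using h2 0, rfl, ?_, fun i => ?_⟩
    · rwa [← Fin.succ_last, Fin.cons_succ] at h1
    · simpa [← Fin.succ_castSucc] using h2 i.succ
  · rintro ⟨rfl, h0, -, h1, h2⟩
    refine ⟨rfl, ?_, fun i => ?_⟩
    · rwa [← Fin.succ_last, Fin.cons_succ]
    · refine Fin.cases ?_ (fun i => ?_) i
      · simpa using h0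
      · simpa [← Fin.succ_castSucc] using h2 i

theorem sum_chainsOfLength_zero {A : Type*} [AddCommMonoid A] (u w : P) [Decidable (u = w)]
    (f : (Fin (0 + 1) → P) → A) :
    ∑ c ∈ chainsOfLength 0 u w, f c = if u = w then f (fun _ => u) else 0 := by
  split_ifs with h
  · subst h
    have : chainsOfLength 0 u u = {fun _ => u} := by
      ext c
      simp only [mem_chainsOfLength, IsMaximalChain, Finset.mem_singleton]
      constructor
      · rintro ⟨h, -⟩
        funext i
        rwa [Fin.fin_one_eq_zero i]
      · rintro rfl
        exact ⟨rfl, rfl, fun i => i.elim0⟩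
    rw [this, Finset.sum_singleton]
  · refine Finset.sum_eq_zero fun c hc => absurd ?_ h
    obtain ⟨h0, h1, -⟩ := mem_chainsOfLength.1 hc
    exact h0.symm.trans h1

theorem sum_chainsOfLength_succ {A : Type*} [AddCommMonoid A] (k : ℕ) (u w : P)
    (f : (Fin (k + 1 + 1) → P) → A) :
    ∑ c ∈ chainsOfLength (k + 1) u w, f c =
      ∑ x ∈ upperCovers u, ∑ c ∈ chainsOfLength k x w, f (Fin.cons u c) := by
  rw [Finset.sum_sigma']
  have key : ∀ c ∈ chainsOfLength (k + 1) u w,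
      c = Fin.cons u (Fin.tail c) ∧ u ⋖ Fin.tail c 0 ∧
        IsMaximalChain (Fin.tail c 0) w (Fin.tail c) := by
    intro c hc
    rw [mem_chainsOfLength, ← Fin.cons_self_tail c, isMaximalChain_cons] at hc
    refine ⟨?_, hc.2⟩
    rw [← hc.1, Fin.cons_self_tail]
  refine Finset.sum_bij' (fun c _ => ⟨Fin.tail c 0, Fin.tail c⟩)
    (fun p _ => (Fin.cons u p.2 : Fin (k + 1 + 1) → P)) ?_ ?_ ?_ ?_ ?_
  · intro c hc
    simpa [mem_upperCovers, mem_chainsOfLength] using (key c hc).2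
  · rintro ⟨x, c⟩ hp
    simp only [Finset.mem_sigma, mem_upperCovers, mem_chainsOfLength] at hp ⊢
    obtain rfl := hp.2.1
    exact isMaximalChain_cons.2 ⟨rfl, hp⟩
  · intro c hc
    exact (key c hc).1.symm
  · rintro ⟨x, c⟩ hp
    simp only [Finset.mem_sigma, mem_upperCovers, mem_chainsOfLength] at hp
    obtain rfl := hp.2.1
    simp
  · intro c hc
    exact congrArg f (key c hc).1

/-- The labels along a chain. -/
def labels {P : Type*} (lam : P → P → ℤ) {k : ℕ} (c : Fin (k + 1) → P) (i : Fin k) : ℤ :=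
  lam (c i.castSucc) (c i.succ)

theorem labels_cons {P : Type*} (lam : P → P → ℤ) {k : ℕ} (u : P) (c : Fin (k + 1) → P) :
    labels lam (Fin.cons u c : Fin (k + 1 + 1) → P) = Fin.cons (lam u (c 0)) (labels lam c) := by
  funext i
  refine Fin.cases ?_ (fun i => ?_) i
  · simp [labels]
  · simp only [labels, Fin.cons_succ, ← Fin.succ_castSucc]

open scoped Classical in
/-- The generating function of the sign choices on chains `u = c_0 ⋖ ⋯ ⋖ c_k = w` for which the
signed labels, preceded by `t`, have no descent, where a tie at a negated label counts as a
descent. Positive signs have weight `α` and negative signs have weight `β`. -/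
noncomputable def ascSum (lam : P → P → ℤ) (α β : ℤ[X]) : ℕ → ℤ → P → P → ℤ[X]
  | 0, _, u, w => if u = w then 1 else 0
  | k + 1, t, u, w => ∑ x ∈ upperCovers u,
      ((if t ≤ lam u x then α * ascSum lam α β k (lam u x) x w else 0) +
        (if t < -lam u x then β * ascSum lam α β k (-lam u x) x w else 0))

variable {lam : P → P → ℤ}

theorem ascSum_eq_zero [GradeMinOrder ℕ P] (α β : ℤ[X]) (k : ℕ) (t : ℤ) (u w : P)
    (h : ¬ (u ≤ w ∧ grade ℕ w = grade ℕ u + k)) : ascSum lam α β k t u w = 0 := by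
  induction k generalizing t u with
  | zero =>
    rw [ascSum, if_neg]
    rintro rfl
    exact h ⟨le_rfl, rfl⟩
  | succ k ih =>
    refine Finset.sum_eq_zero fun x hx => ?_
    have hx := mem_upperCovers.1 hx
    have hg := Nat.covBy_iff_add_one_eq.1 (hx.grade ℕ)
    have : ∀ t, ascSum lam α β k t x w = 0 := fun t =>
      ih t x fun hh => h ⟨hx.le.trans hh.1, by omega⟩
    simp [this]

/-- After a nonnegative value a negated label is a descent or a tie, so the weight of negative signs
never enters. -/
theorem ascSum_of_nonneg (hnonneg : ∀ x y : P, x ⋖ y → 0 ≤ lam x y) (α β : ℤ[X]) (k : ℕ)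
    {t : ℤ} (ht : 0 ≤ t) (u w : P) : ascSum lam α β k t u w = ascSum lam α 0 k t u w := by
  induction k generalizing t u with
  | zero => rfl
  | succ k ih =>
    refine Finset.sum_congr rfl fun x hx => ?_
    have hl := hnonneg u x (mem_upperCovers.1 hx)
    rw [if_neg (c := t < -lam u x) (by omega), if_neg (c := t < -lam u x) (by omega), ih hl]

theorem ascSum_zero_left (β : ℤ[X]) (k : ℕ) (t : ℤ) (u w : P) :
    ascSum lam 0 β k t u w = β ^ k * ascSum lam 0 1 k t u w := by
  induction k generalizing t u with
  | zero => simp [ascSum]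
  | succ k ih =>
    simp only [ascSum, Finset.mul_sum]
    refine Finset.sum_congr rfl fun x _ => ?_
    rw [ih (-lam u x) x]
    split_ifs <;> ring

/-- A sequence of signed labels without descents consists of negated labels followed by
unnegated ones. -/
theorem ascSum_of_nonpos (hnonneg : ∀ x y : P, x ⋖ y → 0 ≤ lam x y) (α β : ℤ[X]) (k : ℕ)
    {t : ℤ} (ht : t ≤ 0) (u w : P) :
    ascSum lam α β k t u w = ∑ j ∈ Finset.range (k + 1), ∑ v,
      ascSum lam 0 β j t u v * ascSum lam α 0 (k - j) 0 v w := by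
  induction k generalizing t u with
  | zero =>
    rw [zero_add, Finset.sum_range_one, Finset.sum_eq_single u]
    · simp [ascSum]
    · intro v _ hv
      simp [ascSum, hv.symm]
    · simp
  | succ k ih =>
    rw [Finset.sum_range_succ']
    have h0 : ∑ v, ascSum lam 0 β 0 t u v * ascSum lam α 0 (k + 1 - 0) 0 v w =
        ascSum lam α 0 (k + 1) 0 u w := by
      rw [Finset.sum_eq_single u]
      · simp [ascSum.eq_1]
      · intro v _ hv
        simp [ascSum.eq_1, hv.symm]
      · simp
    rw [h0, add_comm (Finset.sum _ _)]
    simp only [ascSum.eq_2, Nat.add_sub_add_right, Finset.sum_mul]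
    rw [Finset.sum_add_distrib]
    congr 1
    · refine Finset.sum_congr rfl fun x hx => ?_
      have hl := hnonneg u x (mem_upperCovers.1 hx)
      rw [if_pos (by omega), if_pos hl, ascSum_of_nonneg hnonneg α β k hl]
      simp
    · simp only [Finset.sum_comm (t := upperCovers u)]
      refine Finset.sum_congr rfl fun x hx => ?_
      have hl := hnonneg u x (mem_upperCovers.1 hx)
      rw [ih (t := -lam u x) (by omega)]
      by_cases h : t < -lam u x
      · simp only [if_pos h, Finset.mul_sum, mul_assoc, zero_mul, ite_self, zero_add]
      · simp only [if_neg h, zero_mul, ite_self, zero_add, Finset.sum_const_zero]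

/-- Changing the sign of the last negated or first unnegated label cancels all sign choices but
those without negated labels in which this change creates a descent at the start. -/
theorem ascSum_neg_one (hnonneg : ∀ x y : P, x ⋖ y → 0 ≤ lam x y) (k : ℕ)
    {s : ℤ} (hs : 0 ≤ s) (u w : P) :
    ascSum lam 1 (-1) k (-s) u w = ascSum lam 1 0 k s u w := by
  induction k generalizing s u with
  | zero => rfl
  | succ k ih =>
    refine Finset.sum_congr rfl fun x hx => ?_
    have hl := hnonneg u x (mem_upperCovers.1 hx)
    rw [ih hl, ascSum_of_nonneg hnonneg _ _ _ hl, if_pos (by omega)]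
    -- If the first label is below `s`, both signs are admissible and cancel; otherwise only the
    -- positive sign is admissible.
    by_cases h : lam u x < s
    · rw [if_pos (by omega), if_neg (by omega)]
      simp
    · rw [if_neg (by omega), if_pos (by omega)]
      simp

theorem ascSum_eq_zero_of_forall_lt {s : ℤ} (hs : ∀ x y : P, |lam x y| < s) (α : ℤ[X]) (k : ℕ)
    (hk : k ≠ 0) (u w : P) : ascSum lam α 0 k s u w = 0 := by
  obtain ⟨k, rfl⟩ := Nat.exists_eq_succ_of_ne_zero hk
  refine Finset.sum_eq_zero fun x _ => ?_
  have := abs_lt.1 (hs u x)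
  rw [if_neg (by omega)]
  simp

open scoped Classical in
theorem ascSum_one_zero_eq_card (k : ℕ) (t : ℤ) (u w : P) :
    ascSum lam 1 0 k t u w = ∑ c ∈ chainsOfLength k u w,
      if Monotone (Fin.cons t (labels lam c) : Fin (k + 1) → ℤ) then 1 else 0 := by
  induction k generalizing t u with
  | zero =>
    rw [sum_chainsOfLength_zero, ascSum, if_pos (c := Monotone _)]
    exact fun i j _ => (congrArg _ ((Fin.fin_one_eq_zero i).trans (Fin.fin_one_eq_zero j).symm)).le
  | succ k ih =>
    rw [sum_chainsOfLength_succ]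
    refine Finset.sum_congr rfl fun x hx => ?_
    have h : (if t ≤ lam u x then 1 * ascSum lam 1 0 k (lam u x) x w else 0) =
        ∑ c ∈ chainsOfLength k x w, if t ≤ lam u x ∧
          Monotone (Fin.cons (lam u x) (labels lam c) : Fin (k + 1) → ℤ) then (1 : ℤ[X]) else 0 := by
      by_cases h : t ≤ lam u x <;> simp [h, ih]
    rw [zero_mul, ite_self, add_zero, h]
    refine Finset.sum_congr rfl fun c hc => ?_
    obtain rfl := (mem_chainsOfLength.1 hc).1
    refine if_congr (Iff.symm ?_) rfl rfl
    rw [labels_cons, Fin.monotone_iff_le_succ, Fin.monotone_iff_le_succ, Fin.forall_fin_succ]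
    simp only [Fin.castSucc_zero, Fin.cons_zero, Fin.cons_succ, ← Fin.succ_castSucc]

/-- In an interval with nonnegative `R`-labels there is exactly one increasing chain. -/
theorem ascSum_one_zero_zero [GradeMinOrder ℕ P] (hlam : IsRLabeling lam)
    (hnonneg : ∀ x y : P, x ⋖ y → 0 ≤ lam x y) {u w : P} (huw : u ≤ w) :
    ascSum lam 1 0 (grade ℕ w - grade ℕ u) 0 u w = 1 := by
  rw [ascSum_one_zero_eq_card, Finset.sum_boole]
  obtain ⟨c, hc, huniq⟩ := hlam u w huw
  -- Prefixing `0` to nonnegative labels does not affect monotonicity.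
  have key : ∀ {k : ℕ} {c : Fin (k + 1) → P}, IsMaximalChain u w c →
      (Monotone (Fin.cons 0 (labels lam c) : Fin (k + 1) → ℤ) ↔ Monotone (labels lam c)) := by
    intro k c hc
    constructor
    · intro h i j hij
      simpa using h (Fin.succ_le_succ_iff.2 hij)
    · intro h i
      refine Fin.cases (fun j _ => ?_) (fun i j => ?_) i
      · refine Fin.cases (by simp) (fun j => ?_) j
        simpa [labels] using hnonneg _ _ (hc.2.2 j)
      · refine Fin.cases (fun hij => absurd hij (by simp)) (fun j hij => ?_) j
        simpa using h (Fin.succ_le_succ_iff.1 hij)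
  rw [Finset.card_eq_one.2 ⟨c, ?_⟩, Nat.cast_one]
  ext d
  simp only [Finset.mem_filter, mem_chainsOfLength, Finset.mem_singleton]
  constructor
  · rintro ⟨hd, hm⟩
    exact huniq d ⟨hd, (key hd).1 hm⟩
  · rintro rfl
    exact ⟨hc.1, (key hc.1).2 hc.2⟩

end Paths

/-! ### Möbius function and Poincaré polynomial -/

section Moebius

variable {P : Type*} [PartialOrder P] [Fintype P] [LocallyFiniteOrder P] [GradeMinOrder ℕ P]
  {lam : P → P → ℤ}

/-- Here `v` is where the negated labels end. The unnegated part from `v` to `w` is the unique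
increasing chain, so only the decreasing part from `u` to `v` is left to count. -/
theorem ascSum_eq_sum_Icc (hlam : IsRLabeling lam)
    (hnonneg : ∀ x y : P, x ⋖ y → 0 ≤ lam x y) (β : ℤ[X]) {t : ℤ} (ht : t ≤ 0) (u w : P) :
    ascSum lam 1 β (grade ℕ w - grade ℕ u) t u w = ∑ v ∈ Finset.Icc u w,
      β ^ (grade ℕ v - grade ℕ u) * ascSum lam 0 1 (grade ℕ v - grade ℕ u) t u v := by
  classical
  rw [ascSum_of_nonpos hnonneg 1 β _ ht, Finset.sum_comm]
  symm
  refine Finset.sum_subset_zero_on_sdiff (Finset.subset_univ _) ?_ ?_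
  · intro v hv
    refine Finset.sum_eq_zero fun j _ => ?_
    by_cases huv : u ≤ v
    · rw [ascSum_eq_zero 1 0 _ _ v w, mul_zero]
      rintro ⟨hvw, -⟩
      simp [huv, hvw] at hv
    · rw [ascSum_eq_zero 0 β _ _ u v, zero_mul]
      exact fun h => huv h.1
  · intro v hv
    obtain ⟨huv, hvw⟩ := Finset.mem_Icc.1 hv
    have h1 := grade_mono (𝕆 := ℕ) huv
    have h2 := grade_mono (𝕆 := ℕ) hvw
    rw [Finset.sum_eq_single (grade ℕ v - grade ℕ u)]
    · have h3 : grade ℕ w - grade ℕ u - (grade ℕ v - grade ℕ u) = grade ℕ w - grade ℕ v := by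
        omega
      rw [h3, ascSum_one_zero_zero hlam hnonneg hvw, mul_one, ascSum_zero_left β]
    · intro j _ hj
      rw [ascSum_eq_zero 0 β _ _ u v, zero_mul]
      rintro ⟨-, h⟩
      omega
    · intro h
      exact absurd (Finset.mem_range.2 (by omega)) h

variable [DecidableEq P]

/-- The Möbius function counts the strictly decreasing maximal chains up to sign. -/
theorem mu_eq_ascSum (hlam : IsRLabeling lam) (hnonneg : ∀ x y : P, x ⋖ y → 0 ≤ lam x y)
    {s : ℤ} (hs : ∀ x y : P, |lam x y| < s) {u w : P} (huw : u ≤ w) :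
    C (IncidenceAlgebra.mu ℤ u w) = (-1) ^ (grade ℕ w - grade ℕ u) *
      ascSum lam 0 1 (grade ℕ w - grade ℕ u) (-s) u w := by
  have hs0 : 0 ≤ s := (abs_nonneg _).trans (hs u u).le
  induction w using WellFoundedLT.induction with
  | ind w ih =>
  have h1 := ascSum_eq_sum_Icc hlam hnonneg (-1) (t := -s) (by omega) u w
  -- Both sides are 1 if `u = w` and 0 otherwise; on the right, because no label reaches `s`.
  have h2 : ∑ v ∈ Finset.Icc u w, C (IncidenceAlgebra.mu ℤ u v) =
      ascSum lam 1 (-1) (grade ℕ w - grade ℕ u) (-s) u w := by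
    rw [← map_sum, IncidenceAlgebra.sum_Icc_mu_right, ascSum_neg_one hnonneg _ hs0]
    split_ifs with h
    · subst h
      simp [ascSum]
    · have := grade_strictMono (𝕆 := ℕ) (huw.lt_of_ne h)
      rw [ascSum_eq_zero_of_forall_lt hs _ _ (by omega), map_zero]
  -- By induction the two sums agree term by term for `v < w`, so the terms at `w` agree too.
  rw [h1, ← Finset.sum_Ico_add_eq_sum_Icc huw, ← Finset.sum_Ico_add_eq_sum_Icc huw] at h2
  rw [Finset.sum_congr rfl fun v hv =>
    ih v (Finset.mem_Ico.1 hv).2 (Finset.mem_Ico.1 hv).1] at h2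
  exact add_left_cancel h2

theorem poin_eq_ascSum (hlam : IsRLabeling lam) (hnonneg : ∀ x y : P, x ⋖ y → 0 ≤ lam x y)
    {s : ℤ} (hs : ∀ x y : P, |lam x y| < s) (u w : P) :
    poin u w = ascSum lam 1 X (grade ℕ w - grade ℕ u) (-s) u w := by
  have hs0 : 0 ≤ s := (abs_nonneg _).trans (hs u u).le
  rw [ascSum_eq_sum_Icc hlam hnonneg X (by omega), poin]
  refine Finset.sum_congr rfl fun v hv => ?_
  rw [mu_eq_ascSum hlam hnonneg hs (Finset.mem_Icc.1 hv).1, neg_pow (X : ℤ[X])]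
  have : ((-1 : ℤ[X]) ^ (grade ℕ v - grade ℕ u)) * (-1) ^ (grade ℕ v - grade ℕ u) = 1 := by
    rw [← mul_pow]
    simp
  linear_combination (X ^ (grade ℕ v - grade ℕ u) *
    ascSum lam 0 1 (grade ℕ v - grade ℕ u) (-s) u v) * this

end Moebius

/-! ### Descent words and their expansion in `b` and `a - b` -/

section Words

/-- The word in `a` and `b` whose `b`s mark the descents of the sequence `t, ±l_0, ±l_1, …`, where
`l_i` is negated if `ε i`, and a tie at a negated label counts as a descent. -/
noncomputable def signedWord {k : ℕ} (t : ℤ) (l : Fin k → ℤ) (ε : Fin k → Bool) : ABRing :=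
  let σ : Fin (k + 1) → ℤ := Fin.cons t fun i => if ε i then -l i else l i
  (List.ofFn fun i : Fin k =>
    if σ i.castSucc > σ i.succ ∨ (σ i.castSucc = σ i.succ ∧ ε i) then b else a).prod

theorem signedWord_cons {k : ℕ} (t l₀ : ℤ) (l : Fin k → ℤ) (ε₀ : Bool) (ε : Fin k → Bool) :
    signedWord t (Fin.cons l₀ l : Fin (k + 1) → ℤ) (Fin.cons ε₀ ε : Fin (k + 1) → Bool) =
      (if ε₀ then if -l₀ ≤ t then b else a else if l₀ < t then b else a) *
        signedWord (if ε₀ then -l₀ else l₀) l ε := by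
  rw [signedWord, List.ofFn_succ, List.prod_cons]
  congr 1
  · cases ε₀
    · simp
    · have : (-l₀ < t ∨ t = -l₀) ↔ -l₀ ≤ t := by omega
      simp [this]
  · rw [signedWord]
    congr 2
    funext i
    have : (Fin.cons (if ε₀ = true then -l₀ else l₀) fun i => if ε i = true then -l i else l i :
        Fin (k + 1) → ℤ) = fun i => if (Fin.cons ε₀ ε : Fin (k + 1) → Bool) i = true then
          -(Fin.cons l₀ l : Fin (k + 1) → ℤ) i else (Fin.cons l₀ l : Fin (k + 1) → ℤ) i := by
      funext i
      refine Fin.cases ?_ (fun i => ?_) i <;> simp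
    rw [this]
    simp only [Fin.cons_succ, ← Fin.succ_castSucc]

variable {P : Type*} [PartialOrder P] [Fintype P] (lam : P → P → ℤ)

open scoped Classical in
/-- The sum of the descent words over all maximal chains of length `k` from `u` to `w` and all
sign choices, where the signed labels are preceded by `t` and a negative sign has weight `X`. -/
noncomputable def wordSum (w : P) : ℕ → ℤ → P → ABRing
  | 0, _, u => if u = w then 1 else 0
  | k + 1, t, u => ∑ x ∈ upperCovers u,
      ((if lam u x < t then b else a) * wordSum w k (lam u x) x +
        (X : ℤ[X]) • ((if -lam u x ≤ t then b else a) * wordSum w k (-lam u x) x))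

theorem sum_signedWord (w : P) (k : ℕ) (t : ℤ) (u : P) :
    ∑ c ∈ chainsOfLength k u w, ∑ ε : Fin k → Bool,
      (∏ i, if ε i then (X : ℤ[X]) else 1) • signedWord t (labels lam c) ε =
        wordSum lam w k t u := by
  classical
  induction k generalizing t u with
  | zero =>
    rw [sum_chainsOfLength_zero]
    simp [wordSum, signedWord]
  | succ k ih =>
    rw [sum_chainsOfLength_succ, wordSum]
    refine Finset.sum_congr rfl fun x _ => ?_
    rw [← ih, ← ih, Finset.mul_sum, Finset.mul_sum, Finset.smul_sum, ← Finset.sum_add_distrib]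
    refine Finset.sum_congr rfl fun c hc => ?_
    obtain rfl := (mem_chainsOfLength.1 hc).1
    rw [← (Fin.consEquiv fun _ : Fin (k + 1) => Bool).sum_comp, Fintype.sum_prod_type,
      Fintype.sum_bool, add_comm]
    congr 1
    · rw [Finset.mul_sum]
      refine Finset.sum_congr rfl fun ε _ => ?_
      simp [labels_cons, signedWord_cons, Fin.prod_univ_succ, Fin.consEquiv]
    · rw [Finset.mul_sum, Finset.smul_sum]
      refine Finset.sum_congr rfl fun ε _ => ?_
      simp [labels_cons, signedWord_cons, Fin.prod_univ_succ, Fin.consEquiv, mul_smul]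

/-- Sign sets use the positions `1, …, n`, sign functions the indices `0, …, n - 1`; hence the shift
by one. -/
theorem sum_powerset_Icc {A : Type*} [AddCommMonoid A] (n : ℕ) (f : ℕ → (Fin n → Bool) → A) :
    ∑ E ∈ (Finset.Icc 1 n).powerset, f E.card (fun i => decide ((i : ℕ) + 1 ∈ E)) =
      ∑ ε : Fin n → Bool, f (Finset.univ.filter fun i => ε i).card ε := by
  refine Finset.sum_bij' (fun E _ i => decide ((i : ℕ) + 1 ∈ E))
    (fun ε _ => (Finset.univ.filter fun i => ε i).image fun i : Fin n => (i : ℕ) + 1)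
    ?_ ?_ ?_ ?_ ?_
  · simp
  · intro ε _
    rw [Finset.mem_powerset, Finset.image_subset_iff]
    intro i _
    rw [Finset.mem_Icc]
    omega
  · intro E hE
    ext m
    simp only [Finset.mem_image, Finset.mem_filter, Finset.mem_univ, true_and, decide_eq_true_eq]
    constructor
    · rintro ⟨i, hi, rfl⟩
      exact hi
    · intro hm
      have := Finset.mem_Icc.1 (Finset.mem_powerset.1 hE hm)
      refine ⟨⟨m - 1, by omega⟩, ?_, ?_⟩
      · simpa [Nat.sub_add_cancel this.1]
      · simp only
        omega
  · intro ε _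
    funext i
    simp [Fin.val_inj]
  · intro E hE
    congr 1
    symm
    refine Finset.card_bij (fun i _ => (i : ℕ) + 1) (by simp) ?_ ?_
    · intro i _ j _ hij
      exact Fin.ext (by omega)
    · intro m hm
      have := Finset.mem_Icc.1 (Finset.mem_powerset.1 hE hm)
      refine ⟨⟨m - 1, by omega⟩, ?_, ?_⟩
      · simpa [Nat.sub_add_cancel this.1]
      · simp only
        omega

theorem monTie_eq_signedWord {P : Type*} (lam : P → P → ℤ) {n : ℕ} (M : Fin (n + 1) → P)
    (E : Finset ℕ) :
    monTie lam M E = signedWord 0 (labels lam M) fun i => decide ((i : ℕ) + 1 ∈ E) := by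
  have h : (Fin.cons 0 fun i : Fin n => if (i : ℕ) + 1 ∈ E then -labels lam M i
      else labels lam M i : Fin (n + 1) → ℤ) = signedLabels lam M E := by
    funext i
    refine Fin.cases ?_ (fun i => ?_) i <;> rfl
  simp only [signedWord, decide_eq_true_eq, h]
  rfl

theorem sum_monTie [GradeMinOrder ℕ P] [BoundedOrder P] :
    ∑ M ∈ maximalChains P, ∑ E ∈ (Finset.Icc 1 (grade ℕ (⊤ : P))).powerset,
      (X : ℤ[X]) ^ E.card • monTie lam M E = wordSum lam ⊤ (grade ℕ (⊤ : P)) 0 ⊥ := by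
  rw [← sum_signedWord]
  refine Finset.sum_congr rfl fun M _ => ?_
  simp only [monTie_eq_signedWord]
  rw [sum_powerset_Icc _ fun m ε => (X : ℤ[X]) ^ m • signedWord 0 (labels lam M) ε]
  refine Finset.sum_congr rfl fun ε _ => ?_
  rw [Finset.prod_ite, Finset.prod_const, Finset.prod_const_one, mul_one]

variable {lam} {s : ℤ}

/-- The value `s` lies above every signed label, so the first letter is always `b`. -/
theorem wordSum_succ_of_forall_lt (hs : ∀ x y : P, |lam x y| < s) (w : P) (k : ℕ) (u : P) :
    wordSum lam w (k + 1) s u = b * ∑ x ∈ upperCovers u,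
      (wordSum lam w k (lam u x) x + (X : ℤ[X]) • wordSum lam w k (-lam u x) x) := by
  rw [wordSum, Finset.mul_sum]
  refine Finset.sum_congr rfl fun x _ => ?_
  have := abs_lt.1 (hs u x)
  rw [if_pos (by omega), if_pos (by omega), mul_add, mul_smul_comm]

/-- Splitting off the initial run without descents from each descent word after the substitution
`a = b + (a - b)`. -/
theorem wordSum_eq_sum (hs : ∀ x y : P, |lam x y| < s) (w : P) (k : ℕ) (t : ℤ) (u : P) :
    wordSum lam w k t u = ∑ j ∈ Finset.range (k + 1), ∑ v,
      ascSum lam 1 X j t u v • ((a - b) ^ j * wordSum lam w (k - j) s v) := by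
  classical
  have h0 (k : ℕ) (t : ℤ) (u : P) :
      ∑ v, ascSum lam 1 X 0 t u v • ((a - b) ^ 0 * wordSum lam w (k - 0) s v) =
        wordSum lam w k s u := by
    rw [Finset.sum_eq_single u]
    · simp [ascSum]
    · intro v _ hv
      simp [ascSum, hv.symm]
    · simp
  induction k generalizing t u with
  | zero =>
    rw [zero_add, Finset.sum_range_one, h0]
    rfl
  | succ k ih =>
    rw [Finset.sum_range_succ', h0, wordSum_succ_of_forall_lt hs, Finset.mul_sum]
    simp only [ascSum.eq_2, Finset.sum_smul, Finset.sum_comm (t := upperCovers u)]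
    rw [← Finset.sum_add_distrib, wordSum]
    refine Finset.sum_congr rfl fun x _ => ?_
    have h1 (t' : ℤ) : (a - b) * wordSum lam w k t' x = ∑ j ∈ Finset.range (k + 1), ∑ v,
        ascSum lam 1 X j t' x v • ((a - b) ^ (j + 1) * wordSum lam w (k - j) s v) := by
      rw [ih, Finset.mul_sum]
      simp only [Finset.mul_sum, mul_smul_comm, pow_succ', mul_assoc]
    have h2 : ∑ j ∈ Finset.range (k + 1), ∑ v,
        ((if t ≤ lam u x then 1 * ascSum lam 1 X j (lam u x) x v else 0) +
          if t < -lam u x then X * ascSum lam 1 X j (-lam u x) x v else 0) •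
            ((a - b) ^ (j + 1) * wordSum lam w (k + 1 - (j + 1)) s v) =
        (if t ≤ lam u x then (a - b) * wordSum lam w k (lam u x) x else 0) +
          if t < -lam u x then (X : ℤ[X]) • ((a - b) * wordSum lam w k (-lam u x) x) else 0 := by
      rw [h1, h1]
      simp only [Nat.add_sub_add_right, add_smul, Finset.sum_add_distrib, one_mul]
      congr 1
      · split_ifs <;> simp
      · split_ifs <;> simp [Finset.smul_sum, mul_smul]
    rw [h2]
    -- In both signs `b` is always available and `a - b` is added exactly at a non-descent.
    have e1 : (if lam u x < t then b else a) = b + if t ≤ lam u x then a - b else 0 := by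
      split_ifs <;> first | omega | simp
    have e2 : (if -lam u x ≤ t then b else a) = b + if t < -lam u x then a - b else 0 := by
      split_ifs <;> first | omega | simp
    rw [e1, e2]
    split_ifs <;> simp only [add_mul, mul_add, zero_mul, smul_add, mul_smul_comm, smul_zero] <;>
      abel

end Words

/-! ### Recursion for the extended index over chains -/

section ChainSums

variable {P : Type*} [PartialOrder P] [Fintype P]

open scoped Classical in
/-- The chains containing the maximum all of whose elements satisfy `p`. -/
noncomputable def topChains [OrderTop P] (p : P → Prop) : Finset (Finset P) :=
  Finset.univ.filter fun c =>
    IsChain (· ≤ ·) (c : Set P) ∧ (⊤ : P) ∈ c ∧ ∀ x ∈ c, p x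

/-- The chains from `u` to the maximum. -/
noncomputable def topChainsFrom [OrderTop P] (u : P) : Finset (Finset P) :=
  open scoped Classical in (topChains (u ≤ ·)).filter (u ∈ ·)

theorem mem_topChains [OrderTop P] {p : P → Prop} {c : Finset P} :
    c ∈ topChains p ↔ IsChain (· ≤ ·) (c : Set P) ∧ (⊤ : P) ∈ c ∧ ∀ x ∈ c, p x := by
  simp [topChains]

theorem mem_topChainsFrom [OrderTop P] {u : P} {c : Finset P} :
    c ∈ topChainsFrom u ↔
      (IsChain (· ≤ ·) (c : Set P) ∧ (⊤ : P) ∈ c ∧ ∀ x ∈ c, u ≤ x) ∧ u ∈ c := by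
  simp [topChainsFrom, mem_topChains]

/-- A chain containing `⊤` has a least element, and an upward closed `p` holds on the chain as soon
as it holds there. -/
theorem sum_topChains [OrderTop P] {A : Type*} [AddCommMonoid A] (p : P → Prop) [DecidablePred p]
    (hp : ∀ x y, x ≤ y → p x → p y) (f : Finset P → A) :
    ∑ c ∈ topChains p, f c = ∑ v with p v, ∑ c ∈ topChainsFrom v, f c := by
  classical
  rw [← Finset.sum_biUnion]
  · refine Finset.sum_congr ?_ fun _ _ => rfl
    ext c
    simp only [Finset.mem_biUnion, Finset.mem_filter, Finset.mem_univ, true_and, mem_topChains,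
      mem_topChainsFrom]
    constructor
    · rintro ⟨hc, htop, hpc⟩
      obtain ⟨m, hm⟩ := c.exists_minimal ⟨⊤, htop⟩
      refine ⟨m, hpc m hm.1, ⟨hc, htop, fun x hx => ?_⟩, hm.1⟩
      rcases hc.total hm.1 hx with h | h
      · exact h
      · exact hm.2 hx h
    · rintro ⟨v, hv, ⟨hc, htop, hle⟩, -⟩
      exact ⟨hc, htop, fun x hx => hp v x (hle x hx) hv⟩
  · intro v _ v' _ hne
    refine Finset.disjoint_left.2 fun c hc hc' => hne ?_
    rw [mem_topChainsFrom] at hc hc'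
    exact le_antisymm (hc.1.2.2 _ hc'.2) (hc'.1.2.2 _ hc.2)

theorem topChainsFrom_top [OrderTop P] : topChainsFrom (⊤ : P) = {{⊤}} := by
  ext c
  rw [mem_topChainsFrom, Finset.mem_singleton]
  constructor
  · rintro ⟨⟨-, h, hle⟩, -⟩
    ext x
    rw [Finset.mem_singleton]
    exact ⟨fun hx => top_le_iff.1 (hle x hx), fun hx => hx ▸ h⟩
  · rintro rfl
    simp

variable [DecidableEq P]

theorem sum_topChainsFrom [OrderTop P] {A : Type*} [AddCommMonoid A] {u : P} (hu : u ≠ ⊤)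
    (f : Finset P → A) :
    ∑ c ∈ topChainsFrom u, f c = ∑ c ∈ topChains (u < ·), f (insert u c) := by
  refine Finset.sum_bij' (fun c _ => c.erase u) (fun c _ => insert u c) ?_ ?_ ?_ ?_ ?_
  · intro c hc
    obtain ⟨⟨hc, htop, hle⟩, -⟩ := mem_topChainsFrom.1 hc
    refine mem_topChains.2 ⟨hc.mono (by simp), Finset.mem_erase.2 ⟨hu.symm, htop⟩, fun x hx => ?_⟩
    obtain ⟨hxu, hx⟩ := Finset.mem_erase.1 hx
    exact (hle x hx).lt_of_ne hxu.symm
  · intro c hc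
    obtain ⟨hc, htop, hlt⟩ := mem_topChains.1 hc
    refine mem_topChainsFrom.2
      ⟨⟨?_, Finset.mem_insert_of_mem htop, ?_⟩, Finset.mem_insert_self u c⟩
    · rw [Finset.coe_insert]
      exact hc.insert fun x hx _ => Or.inl (hlt x hx).le
    · intro x hx
      rcases Finset.mem_insert.1 hx with rfl | hx
      · exact le_rfl
      · exact (hlt x hx).le
  · intro c hc
    exact Finset.insert_erase (mem_topChainsFrom.1 hc).2
  · intro c hc
    exact Finset.erase_insert fun h => lt_irrefl u ((mem_topChains.1 hc).2.2 u h)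
  · intro c hc
    rw [Finset.insert_erase (mem_topChainsFrom.1 hc).2]

/-- The only new pair of consecutive elements is `(u, v)`, since `v` lies strictly between `u` and
any other element of `c`. -/
theorem chainPoin_insert [OrderTop P] [LocallyFiniteOrder P] [GradeMinOrder ℕ P] {u v : P}
    (huv : u < v) {c : Finset P} (hc : c ∈ topChainsFrom v) :
    chainPoin (insert u c) = poin u v * chainPoin c := by
  classical
  obtain ⟨⟨-, -, hle⟩, hvc⟩ := mem_topChainsFrom.1 hc
  have hlt : ∀ x ∈ c, u < x := fun x hx => huv.trans_le (hle x hx)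
  have huc : u ∉ c := fun h => lt_irrefl u (hlt u h)
  rw [chainPoin, chainPoin, ← Finset.prod_insert (a := (u, v)) (f := fun p => poin p.1 p.2)]
  · refine Finset.prod_congr ?_ fun _ _ => rfl
    ext ⟨x, y⟩
    simp only [Finset.mem_filter, Finset.mem_product, Finset.mem_insert, Prod.mk.injEq,
      forall_eq_or_imp]
    constructor
    · rintro ⟨⟨rfl | hx, rfl | hy⟩, hxy, -, h⟩
      · exact absurd hxy (lt_irrefl _)
      · refine Or.inl ⟨rfl, ((hle y hy).eq_of_not_lt fun hvy => h v hvc ⟨huv, hvy⟩).symm⟩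
      · exact absurd (hxy.trans (hlt x hx)) (lt_irrefl _)
      · exact Or.inr ⟨⟨hx, hy⟩, hxy, h⟩
    · rintro (⟨rfl, rfl⟩ | ⟨⟨hx, hy⟩, hxy, h⟩)
      · exact ⟨⟨Or.inl rfl, Or.inr hvc⟩, huv, fun h => lt_irrefl _ h.1,
          fun x hx h => (hle x hx).not_gt h.2⟩
      · exact ⟨⟨Or.inr hx, Or.inr hy⟩, hxy, fun h => lt_asymm (hlt x hx) h.1, h⟩
  · simp [huc]

/-- The letters `m, …, n - 1` of the word `wt n S`. -/
noncomputable def wtFrom (m n : ℕ) (S : Finset ℕ) : ABRing :=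
  ((List.range' m (n - m)).map fun k => if k ∈ S then b else a - b).prod

theorem wt_eq_wtFrom (n : ℕ) (S : Finset ℕ) : wt n S = wtFrom 0 n S := by
  rw [wt, wtFrom, List.ofFn_eq_map, Nat.sub_zero, ← List.range_eq_range',
    ← List.map_coe_finRange_eq_range, List.map_map]
  rfl

theorem wtFrom_congr {m n : ℕ} {S T : Finset ℕ} (h : ∀ k, m ≤ k → (k ∈ S ↔ k ∈ T)) :
    wtFrom m n S = wtFrom m n T := by
  rw [wtFrom, wtFrom]
  congr 1
  refine List.map_congr_left fun k hk => ?_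
  simp only [h k (List.mem_range'_1.1 hk).1]

theorem wtFrom_eq_pow_mul {m r n : ℕ} (hmr : m ≤ r) (hrn : r ≤ n) {S : Finset ℕ}
    (h : ∀ k ∈ S, r ≤ k) : wtFrom m n S = (a - b) ^ (r - m) * wtFrom r n S := by
  have h1 : List.range' m (n - m) = List.range' m (r - m) ++ List.range' r (n - r) := by
    have := List.range'_append_1 (s := m) (m := r - m) (n := n - r)
    rw [show m + (r - m) = r by omega, show r - m + (n - r) = n - m by omega] at this
    exact this.symm
  rw [wtFrom, h1, List.map_append, List.prod_append, wtFrom]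
  congr 1
  rw [List.prod_eq_pow_card _ (a - b), List.length_map, List.length_range']
  intro x hx
  obtain ⟨k, hk, rfl⟩ := List.mem_map.1 hx
  have := List.mem_range'_1.1 hk
  rw [if_neg fun hkS => ?_]
  have := h k hkS
  omega

theorem wtFrom_eq_mul_pow_mul {m r n : ℕ} (hmr : m < r) (hrn : r ≤ n) {S : Finset ℕ}
    (h : ∀ k ∈ S, r ≤ k) :
    wtFrom m n (insert m S) = b * ((a - b) ^ (r - m - 1) * wtFrom r n S) := by
  have h1 : n - m = (n - (m + 1)) + 1 := by omega
  have h2 : wtFrom m n (insert m S) = b * wtFrom (m + 1) n (insert m S) := by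
    rw [wtFrom, h1, List.range'_succ, List.map_cons, List.prod_cons,
      if_pos (Finset.mem_insert_self m S), wtFrom]
  have h3 : wtFrom (m + 1) n (insert m S) = wtFrom (m + 1) n S :=
    wtFrom_congr fun k hk => by
      rw [Finset.mem_insert]
      exact or_iff_right (by omega)
  rw [h2, h3, wtFrom_eq_pow_mul hmr hrn h, Nat.sub_sub]

theorem le_of_mem_image_grade [BoundedOrder P] [GradeMinOrder ℕ P] {v : P} {c : Finset P}
    (hc : c ∈ topChainsFrom v) : ∀ k ∈ (c.erase ⊤).image (grade ℕ), grade ℕ v ≤ k := by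
  intro k hk
  obtain ⟨x, hx, rfl⟩ := Finset.mem_image.1 hk
  exact grade_mono ((mem_topChainsFrom.1 hc).1.2.2 x (Finset.mem_of_mem_erase hx))

theorem mem_maximalChains {P : Type*} [PartialOrder P] [Fintype P] [BoundedOrder P]
    [GradeMinOrder ℕ P] {M : Fin (grade ℕ (⊤ : P) + 1) → P} :
    M ∈ maximalChains P ↔ IsMaximalChain ⊥ ⊤ M := by
  simp [maximalChains]

variable [BoundedOrder P] [LocallyFiniteOrder P] [GradeMinOrder ℕ P]

open scoped Classical in
/-- The part of `exPsi` coming from the chains with minimum `u`, without the letters at the ranks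
below `u`. -/
noncomputable def exPsiFrom (u : P) : ABRing :=
  ∑ c ∈ topChainsFrom u,
    chainPoin c • wtFrom (grade ℕ u) (grade ℕ (⊤ : P)) ((c.erase ⊤).image (grade ℕ))

theorem exPsi_eq_sum : exPsi P = ∑ v : P, (a - b) ^ grade ℕ v * exPsiFrom v := by
  classical
  have h := sum_topChains (fun _ : P => True) (fun _ _ _ _ => trivial) fun c =>
    chainPoin c • wt (grade ℕ (⊤ : P)) ((c.erase ⊤).image (grade ℕ))
  have htop : (Finset.univ.filter fun c : Finset P =>
      IsChain (· ≤ ·) (c : Set P) ∧ (⊤ : P) ∈ c) = topChains fun _ => True := by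
    ext c
    simp [mem_topChains]
  rw [exPsi, htop, h, Finset.filter_true]
  refine Finset.sum_congr rfl fun v _ => ?_
  rw [exPsiFrom, Finset.mul_sum]
  refine Finset.sum_congr rfl fun c hc => ?_
  rw [wt_eq_wtFrom, wtFrom_eq_pow_mul (Nat.zero_le _) (grade_mono le_top)
    (le_of_mem_image_grade hc), Nat.sub_zero, mul_smul_comm]

theorem exPsiFrom_top : exPsiFrom (⊤ : P) = 1 := by
  rw [exPsiFrom, topChainsFrom_top, Finset.sum_singleton]
  have : chainPoin ({⊤} : Finset P) = 1 := by
    refine Finset.prod_eq_one fun p hp => ?_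
    simp only [Finset.mem_filter, Finset.mem_product, Finset.mem_singleton] at hp
    rw [hp.1.1, hp.1.2] at hp
    exact absurd hp.2.1 (lt_irrefl _)
  simp [this, wtFrom]

-- Sorting chains by their second element `v`: the rank of `u` carries `b`, and the `rk v - rk u -
-- 1` ranks strictly between carry `a - b`.
open scoped Classical in
theorem exPsiFrom_of_ne_top {u : P} (hu : u ≠ ⊤) :
    exPsiFrom u = ∑ v with u < v,
      poin u v • (b * ((a - b) ^ (grade ℕ v - grade ℕ u - 1) * exPsiFrom v)) := by
  rw [exPsiFrom, sum_topChainsFrom hu, sum_topChains (u < ·) fun _ _ h h' => h'.trans_le h]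
  refine Finset.sum_congr rfl fun v hv => ?_
  have huv : u < v := (Finset.mem_filter.1 hv).2
  rw [exPsiFrom, Finset.mul_sum, Finset.mul_sum, Finset.smul_sum]
  refine Finset.sum_congr rfl fun c hc => ?_
  rw [chainPoin_insert huv hc, Finset.erase_insert_of_ne hu, Finset.image_insert,
    wtFrom_eq_mul_pow_mul (grade_strictMono huv) (grade_mono le_top) (le_of_mem_image_grade hc),
    mul_smul, mul_smul_comm, mul_smul_comm]

/-! ### Comparison of the extended index with descent words -/

variable {lam : P → P → ℤ} {s : ℤ}

/-- Both sides satisfy the recursion of `exPsiFrom_of_ne_top`: after the forced `b` the next label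
is free, as if preceded by `-s`, so the following run is counted by a Poincaré polynomial. -/
theorem exPsiFrom_eq_wordSum (hlam : IsRLabeling lam)
    (hnonneg : ∀ x y : P, x ⋖ y → 0 ≤ lam x y) (hs : ∀ x y : P, |lam x y| < s) (u : P) :
    exPsiFrom u = wordSum lam ⊤ (grade ℕ (⊤ : P) - grade ℕ u) s u := by
  classical
  induction u using WellFoundedGT.induction with
  | ind u ih =>
  by_cases hu : u = ⊤
  · subst hu
    rw [exPsiFrom_top, Nat.sub_self, wordSum, if_pos rfl]
  have hlt := grade_strictMono (𝕆 := ℕ) (lt_top_iff_ne_top.2 hu)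
  obtain ⟨k, hk⟩ : ∃ k, grade ℕ (⊤ : P) - grade ℕ u = k + 1 :=
    ⟨_, (Nat.sub_add_cancel (by omega : 1 ≤ _)).symm⟩
  -- The unconstrained first step joins the run, so a run of length `j + 1` carries only `j` letters
  -- `a - b`.
  have h1 : ∑ x ∈ upperCovers u,
      (wordSum lam ⊤ k (lam u x) x + (X : ℤ[X]) • wordSum lam ⊤ k (-lam u x) x) =
      ∑ j ∈ Finset.range (k + 1), ∑ v, ascSum lam 1 X (j + 1) (-s) u v •
        ((a - b) ^ j * wordSum lam ⊤ (k - j) s v) := by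
    simp only [ascSum.eq_2, Finset.sum_smul, Finset.sum_comm (t := upperCovers u)]
    refine Finset.sum_congr rfl fun x _ => ?_
    have := abs_lt.1 (hs u x)
    have hpos : -s ≤ lam u x := by omega
    have hneg : -s < -lam u x := by omega
    rw [wordSum_eq_sum hs, wordSum_eq_sum hs ⊤ k (-lam u x)]
    simp only [if_pos hpos, if_pos hneg, Finset.smul_sum, ← Finset.sum_add_distrib, add_smul,
      one_mul, mul_smul]
  rw [hk, wordSum_succ_of_forall_lt hs, h1, exPsiFrom_of_ne_top hu, Finset.sum_comm,
    Finset.mul_sum]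
  refine Finset.sum_subset_zero_on_sdiff (Finset.subset_univ _) ?_ ?_
  · intro v hv
    rw [Finset.sum_eq_zero, mul_zero]
    intro j _
    rw [ascSum_eq_zero, zero_smul]
    rintro ⟨huv, hg⟩
    refine (Finset.mem_sdiff.1 hv).2 (Finset.mem_filter.2 ⟨Finset.mem_univ v, huv.lt_of_ne ?_⟩)
    rintro rfl
    omega
  · intro v hv
    have huv : u < v := (Finset.mem_filter.1 hv).2
    have hg := grade_strictMono (𝕆 := ℕ) huv
    have hgt := grade_mono (𝕆 := ℕ) (le_top (a := v))
    rw [ih v huv, poin_eq_ascSum hlam hnonneg hs,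
      Finset.sum_eq_single (grade ℕ v - grade ℕ u - 1), mul_smul_comm]
    · rw [Nat.sub_add_cancel (by omega),
        show k - (grade ℕ v - grade ℕ u - 1) = grade ℕ (⊤ : P) - grade ℕ v by omega]
    · intro j _ hj
      rw [ascSum_eq_zero, zero_smul]
      rintro ⟨-, hg⟩
      omega
    · intro h
      exact absurd (Finset.mem_range.2 (by omega)) h

theorem exPsi_eq_wordSum (hlam : IsRLabeling lam)
    (hnonneg : ∀ x y : P, x ⋖ y → 0 ≤ lam x y) :
    exPsi P = wordSum lam ⊤ (grade ℕ (⊤ : P)) 0 ⊥ := by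
  classical
  -- Finiteness of `P` bounds the labels, including the irrelevant values off cover relations.
  obtain ⟨s, hs⟩ : ∃ s : ℤ, ∀ x y : P, |lam x y| < s := by
    obtain ⟨s, hs⟩ := (Set.finite_range fun p : P × P => |lam p.1 p.2|).bddAbove
    exact ⟨s + 1, fun x y => Int.lt_add_one_of_le (hs ⟨(x, y), rfl⟩)⟩
  have hbot : grade ℕ (⊥ : P) = 0 := grade_bot
  rw [exPsi_eq_sum, wordSum_eq_sum hs, Finset.sum_comm]
  refine Finset.sum_congr rfl fun v _ => ?_
  have hg := grade_mono (𝕆 := ℕ) (le_top (a := v))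
  rw [exPsiFrom_eq_wordSum hlam hnonneg hs, Finset.sum_eq_single (grade ℕ v)]
  -- The run from `⊥` to `v` is preceded by `0`, so it is the unique increasing chain with all signs
  -- positive.
  · have h := ascSum_one_zero_zero hlam hnonneg (bot_le (a := v))
    rw [hbot, Nat.sub_zero] at h
    rw [ascSum_of_nonneg hnonneg 1 X _ le_rfl, h, one_smul]
  · intro j _ hj
    rw [ascSum_eq_zero, zero_smul]
    rintro ⟨-, h⟩
    omega
  · intro h
    exact absurd (Finset.mem_range.2 (by omega)) h

end ChainSums

/-! ### The plain descent rule -/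

/-- Without zero labels and consecutive equal labels there are no ties. -/
theorem mon_eq_monTie {P : Type*} [PartialOrder P] {lam : P → P → ℤ}
    (hpos : ∀ x y : P, x ⋖ y → 0 < lam x y)
    (hne : ∀ x y z : P, x ⋖ y → y ⋖ z → lam x y ≠ lam y z)
    {n : ℕ} {u w : P} {M : Fin (n + 1) → P} (hM : IsMaximalChain u w M) (E : Finset ℕ) :
    mon lam M E = monTie lam M E := by
  rw [mon, monTie]
  congr 2
  funext i
  refine if_congr (or_iff_left ?_).symm rfl rfl
  rintro ⟨heq, hi⟩
  have hsucc : signedLabels lam M E i.succ = -lam (M i.castSucc) (M i.succ) := if_pos hi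
  rw [hsucc] at heq
  have hi' := hpos _ _ (hM.2.2 i)
  cases n with
  | zero => exact i.elim0
  | succ n =>
    induction i using Fin.cases with
    | zero =>
      have h0 : signedLabels lam M E (Fin.castSucc 0) = 0 := rfl
      omega
    | succ j =>
      have hj : signedLabels lam M E j.succ.castSucc =
          if (j : ℕ) + 1 ∈ E then -lam (M j.castSucc.castSucc) (M j.succ.castSucc)
          else lam (M j.castSucc.castSucc) (M j.succ.castSucc) := rfl
      have hcov := hM.2.2 j.castSucc
      rw [Fin.succ_castSucc] at hcov
      have hj' := hpos _ _ hcov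
      have := hne _ _ _ hcov (hM.2.2 j.succ)
      split_ifs at hj <;> omega

end ABIndex

theorem corollary2p3 {P : Type*} [PartialOrder P] [BoundedOrder P] [Fintype P]
    [LocallyFiniteOrder P] [DecidableEq P] [GradeMinOrder ℕ P]
    (lam : P → P → ℤ) (hlam : ABIndex.IsRLabeling lam)
    (hnonneg : ∀ x y : P, x ⋖ y → 0 ≤ lam x y) :
    ABIndex.exPsi P =
        ∑ M ∈ ABIndex.maximalChains P, ∑ E ∈ (Finset.Icc 1 (grade ℕ (⊤ : P))).powerset,
          (Polynomial.X : Polynomial ℤ) ^ E.card • ABIndex.monTie lam M E ∧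
    ((∀ x y : P, x ⋖ y → 0 < lam x y) →
      (∀ x y z : P, x ⋖ y → y ⋖ z → lam x y ≠ lam y z) →
      ABIndex.exPsi P =
        ∑ M ∈ ABIndex.maximalChains P, ∑ E ∈ (Finset.Icc 1 (grade ℕ (⊤ : P))).powerset,
          (Polynomial.X : Polynomial ℤ) ^ E.card • ABIndex.mon lam M E) := by
  have h := (ABIndex.exPsi_eq_wordSum hlam hnonneg).trans (ABIndex.sum_monTie lam).symm
  refine ⟨h, fun hpos hne => h.trans (Finset.sum_congr rfl fun M hM => ?_)⟩
  refine Finset.sum_congr rfl fun E _ => ?_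
  rw [ABIndex.mon_eq_monTie hpos hne (ABIndex.mem_maximalChains.1 hM)]
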